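/- Let $n\in\mathbb N$, let $\Omega\subset\mathbb C^n=\mathbb R^{2n}$ be a domain (a nonempty connected open set) and let $E\subset\mathbb C^n$ be a closed set, where $d$ denotes the Euclidean distance (with $d(z,\emptyset)=+\infty$). Assume that (1) there exists $r>0$ such that $E_r:=\{z\in\mathbb C^n : d(z,E)\le r\}\subset\Omega$; (2) there exist a (nonempty) real affine subspace $H\subset\mathbb R^{2n}=\mathbb C^n$ of real codimension $\ge 3$ and a number $R>0$ such that $E\subset H_R:=\{z\in\mathbb C^n : d(z,H)<R\}$; (3) $\Omega\setminus E$ is connected. Then every holomorphic function $f$ on $\Omega\setminus E$ with $\int_{\Omega\setminus E}|f|^2<\infty$ extends to a holomorphic function on $\Omega$ which is square integrable: there is a holomorphic $F:\Omega\to\mathbb C$ with $F=f$ on $\Omega\setminus E$ and $\int_\Omega|F|^2<\infty$. (Integrals are with respect to Lebesgue measure.) -/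

import Mathlib

open MeasureTheory

/-! This is Ehrenpreis' ∂̄-proof of Hartogs extension, with bounded slices in place of a compact
singular set. Take a cutoff `c` that is 0 near `E` and 1 off a closed neighbourhood `S` of `E`
inside `Ω`. Then `f * c` is smooth on `Ω`, and its ∂̄-derivative `v a = f * dbar c a` is a ∂̄-closed
form supported in `S`. If `dbar u a = v a` for all `a`, then `F = f * c - u` is holomorphic on `Ω`.
It equals `f` wherever `c = 1` and `u = 0`, hence on all of the connected set `Ω \ E` once this
holds near one point.

Codimension at least 3 provides a complex direction `e` along which `H` is transversal, and a
further real functional `m`, constant along `e` and bounded above on `E`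
(`exists_transversal_complex_line`). Slices of `S` by lines parallel to `e` are therefore bounded,
so the one-variable Cauchy transform along these lines solves the equation. Lines with `m` large
miss `S`, so `u` vanishes there; a clopen argument (`exists_mem_eventuallyEq_zero`) carries this
vanishing into `Ω \ S`.

Square integrability on `E`, where `F = -u`, is a Young inequality: only a bounded part of the
kernel acts between points of `S`, and that part is integrable. -/

/-! ### Holomorphic functions of several variables: C¹ regularity and the identity theorem. -/

theorem contDiffOn_one_of_differentiableOn_complex {X : Type*} [NormedAddCommGroup X]
    [NormedSpace ℂ X] [FiniteDimensional ℂ X] {U : Set X} {f : X → ℂ} (hU : IsOpen U)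
    (hf : DifferentiableOn ℂ f U) : ContDiffOn ℂ 1 f U := by
  have : ProperSpace X := FiniteDimensional.proper ℂ X
  have h1 : ContDiffOn ℂ (0 + 1) f U ↔ _ := contDiffOn_succ_iff_fderiv_of_isOpen hU
  rw [zero_add] at h1
  refine h1.2 ⟨hf, by simp, contDiffOn_zero.2 fun x hx => ?_⟩
  apply ContinuousAt.continuousWithinAt
  obtain ⟨ρ, hρ, hρU⟩ := Metric.nhds_basis_closedBall.mem_iff.1 (hU.mem_nhds hx)
  set δ := ρ / 2 with hδ
  have hδ0 : 0 < δ := by positivity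
  have huc : UniformContinuousOn f (Metric.closedBall x ρ) :=
    (isCompact_closedBall x ρ).uniformContinuousOn_of_continuous (hf.continuousOn.mono hρU)
  rw [Metric.continuousAt_iff]
  intro ε hε
  -- Cauchy's estimate on the circle of radius `δ`, applied to `t ↦ f (y + t • a) - f (x + t • a)`,
  -- divides this bound by `δ`.
  obtain ⟨η, hη, hfη⟩ := Metric.uniformContinuousOn_iff.1 huc (ε / 2 * δ) (by positivity)
  refine ⟨min η δ, by positivity, fun {y} hy => ?_⟩
  have hyη : dist y x < η := hy.trans_le (min_le_left _ _)
  have hyδ : dist y x < δ := hy.trans_le (min_le_right _ _)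
  rw [dist_eq_norm]
  let : NormedSpace ℝ X := NormedSpace.restrictScalars ℝ ℂ X
  suffices h : ∀ a : X, ‖a‖ = 1 → ‖(fderiv ℂ f y - fderiv ℂ f x) a‖ ≤ ε / 2 by
    refine lt_of_le_of_lt (ContinuousLinearMap.opNorm_le_bound _ (half_pos hε).le fun a => ?_)
      (half_lt_self hε)
    rcases eq_or_ne a 0 with rfl | ha
    · simp
    have h2 := h (((‖a‖⁻¹ : ℝ) : ℂ) • a) (by
      rw [norm_smul, Complex.norm_real, norm_inv, norm_norm, inv_mul_cancel₀ (norm_ne_zero_iff.2 ha)])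
    rw [map_smul, norm_smul, Complex.norm_real, norm_inv, norm_norm,
      inv_mul_le_iff₀ (norm_pos_iff.2 ha)] at h2
    linarith
  intro a ha
  have hmem : ∀ z, dist z x < δ → ∀ t : ℂ, ‖t‖ ≤ δ → z + t • a ∈ Metric.closedBall x ρ := by
    intro z hz t ht
    rw [Metric.mem_closedBall, dist_eq_norm]
    have : z + t • a - x = (z - x) + t • a := by abel
    rw [this]
    refine (norm_add_le _ _).trans ?_
    rw [norm_smul, ha, ← dist_eq_norm]
    linarith
  have hd : ∀ z, dist z x < δ → ∀ t : ℂ, ‖t‖ ≤ δ →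
      HasDerivAt (fun t : ℂ => f (z + t • a)) (fderiv ℂ f (z + t • a) a) t := by
    intro z hz t ht
    have h2 := (hf.differentiableAt (hU.mem_nhds (hρU (hmem z hz t ht)))).hasFDerivAt
    have h3 : HasDerivAt (fun t : ℂ => z + t • a) a t := by
      simpa using ((hasDerivAt_id t).smul_const a).const_add z
    exact h2.comp_hasDerivAt t h3
  have hx0 : dist x x < δ := by simpa
  have key := Complex.norm_deriv_le_of_forall_mem_sphere_norm_le (c := 0) (C := ε / 2 * δ)
    (f := fun t : ℂ => f (y + t • a) - f (x + t • a)) hδ0 ?_ ?_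
  · have := ((hd y hyδ 0 (by simpa using hδ0.le)).sub (hd x hx0 0 (by simpa using hδ0.le))).deriv
    simp only [zero_smul, add_zero] at this
    change deriv (fun t : ℂ => f (y + t • a) - f (x + t • a)) 0 = _ at this
    rw [this, mul_div_cancel_right₀ _ hδ0.ne'] at key
    simpa using key
  · apply DifferentiableOn.diffContOnCl
    rw [closure_ball _ hδ0.ne']
    intro t ht
    have ht' : ‖t‖ ≤ δ := by simpa using ht
    exact ((hd y hyδ t ht').sub (hd x hx0 t ht')).differentiableAt.differentiableWithinAt
  · intro t ht
    have ht' : ‖t‖ ≤ δ := by simpa using ht.le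
    rw [← dist_eq_norm]
    refine (hfη _ (hmem y hyδ t ht') _ (hmem x hx0 t ht') ?_).le
    simpa using hyη

/-- The complex line through `x` and `y` meets `U` in a convex set, so the one-variable identity
theorem applies there. -/
theorem eq_zero_of_eventuallyEq_zero_of_convex {X : Type*} [NormedAddCommGroup X]
    [NormedSpace ℂ X] {U : Set X} {f : X → ℂ} (hU : IsOpen U) (hc : Convex ℝ U)
    (hf : DifferentiableOn ℂ f U) {x y : X} (hx : x ∈ U) (hy : y ∈ U) (h0 : f =ᶠ[nhds x] 0) :
    f y = 0 := by
  let φ : ℂ → X := fun t => x + t • (y - x)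
  have hφ : Differentiable ℂ φ := by fun_prop
  have hV : IsOpen (φ ⁻¹' U) := hU.preimage hφ.continuous
  have hVc : Convex ℝ (φ ⁻¹' U) := by
    intro s hs t ht a b ha hb hab
    have : φ (a • s + b • t) = a • φ s + b • φ t := by
      obtain rfl : b = 1 - a := by linarith
      have hsm : ∀ (r : ℝ) (z : X), r • z = (r : ℂ) • z := fun r z => (Complex.coe_smul r z).symm
      simp only [φ, Complex.real_smul, hsm]
      push_cast
      module
    simp only [Set.mem_preimage, this]
    exact hc hs ht ha hb hab
  have han : AnalyticOnNhd ℂ (f ∘ φ) (φ ⁻¹' U) :=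
    (hf.comp hφ.differentiableOn (Set.mapsTo_preimage _ _)).analyticOnNhd hV
  have h0' : f ∘ φ =ᶠ[nhds 0] 0 := by
    have : Filter.Tendsto φ (nhds 0) (nhds x) := by
      simpa [φ] using hφ.continuous.tendsto 0
    exact this.eventually h0
  have := han.eqOn_zero_of_preconnected_of_eventuallyEq_zero hVc.isPreconnected
    (by simpa [φ] using hx) h0' (show (1 : ℂ) ∈ φ ⁻¹' U by simpa [φ] using hy)
  simpa [φ] using this

theorem eqOn_zero_of_eventuallyEq_zero_of_isPreconnected {X : Type*} [NormedAddCommGroup X]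
    [NormedSpace ℂ X] {U : Set X} {f : X → ℂ} (hU : IsOpen U) (hc : IsPreconnected U)
    (hf : DifferentiableOn ℂ f U) {x : X} (hx : x ∈ U) (h0 : f =ᶠ[nhds x] 0) :
    Set.EqOn f 0 U := by
  have hsub : U ⊆ {y | f =ᶠ[nhds y] 0} := by
    refine hc.subset_of_closure_inter_subset isOpen_setOfPred_eventually_nhds ⟨x, hx, h0⟩ ?_
    rintro z ⟨hz, hzU⟩
    obtain ⟨ε, hε, hb⟩ := Metric.isOpen_iff.1 hU z hzU
    obtain ⟨w, hw, hwb⟩ := Metric.mem_closure_iff.1 hz ε hε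
    have hwb' : w ∈ Metric.ball z ε := by rwa [Metric.mem_ball, dist_comm]
    filter_upwards [Metric.ball_mem_nhds z hε] with y hy
    exact eq_zero_of_eventuallyEq_zero_of_convex Metric.isOpen_ball
      (convex_ball z ε) (hf.mono hb) hwb' hy hw
  exact fun y hy => (hsub hy).self_of_nhds

/-! ### The Cauchy–Pompeiu formula in the plane. -/

theorem locallyIntegrable_complex_inv : LocallyIntegrable (fun z : ℂ => z⁻¹) := by
  refine locallyIntegrable_of_norm_le_rpow (C := 1) (α := 1) (by simp) (by simp) ?_
    (by fun_prop)
  exact Filter.Eventually.of_forall fun z => by simp [Real.rpow_neg_one]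

/-- Twice the antilinear part of the real derivative of `h` at `p`, applied to `a`. -/
noncomputable def dbar {X : Type*} [NormedAddCommGroup X] [NormedSpace ℂ X] (h : X → ℂ)
    (a p : X) : ℂ :=
  fderiv ℝ h p a + Complex.I * fderiv ℝ h p (Complex.I • a)

/-- `D a + I * D (I * a)` is antilinear in `a`, so a factor comes out conjugated; on the unit circle
the conjugate is the inverse, as in the polar form of the kernel. -/
theorem dbar_one_mul_eq (D : ℂ →L[ℝ] ℂ) (c s : ℝ) :
    D (c + s * Complex.I) + Complex.I * D (Complex.I * (c + s * Complex.I)) =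
      (c - s * Complex.I) * (D 1 + Complex.I * D Complex.I) := by
  have h1 : (c + s * Complex.I : ℂ) = c • (1 : ℂ) + s • Complex.I := by simp
  have h2 : Complex.I * (c + s * Complex.I : ℂ) = c • Complex.I - s • (1 : ℂ) := by
    simp only [Complex.real_smul]
    linear_combination (s : ℂ) * Complex.I_sq
  rw [h2, h1, map_add, map_sub, map_smul, map_smul, map_smul, map_smul]
  simp only [Complex.real_smul]
  linear_combination (s : ℂ) * D Complex.I * Complex.I_sq

/-- In polar coordinates the integrand becomes `P + I * Q`, with `P` the radial derivative of `ψ`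
and `ρ * Q` the angular one. `P` integrates along each ray to `-ψ 0`, and `Q` integrates to 0 over a
period. -/
theorem integral_inv_mul_dbar {ψ : ℂ → ℂ} (hψ : ContDiff ℝ 1 ψ) (hc : HasCompactSupport ψ) :
    ∫ z, z⁻¹ * dbar ψ 1 z = -(2 * Real.pi) * ψ 0 := by
  rw [← Complex.integral_comp_polarCoord_symm]
  let u : ℝ → ℂ := fun θ => Real.cos θ + Real.sin θ * Complex.I
  have hu : Continuous u := by fun_prop
  have hun : ∀ θ, ‖u θ‖ = 1 := fun θ => by
    have := Complex.norm_exp_ofReal_mul_I θ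
    rwa [Complex.exp_mul_I, ← Complex.ofReal_cos, ← Complex.ofReal_sin] at this
  have hu' : ∀ θ, HasDerivAt u (Complex.I * u θ) θ := fun θ => by
    have h1 := (Real.hasDerivAt_cos θ).ofReal_comp
    have h2 := (Real.hasDerivAt_sin θ).ofReal_comp.mul_const Complex.I
    refine (h1.add h2).congr_deriv ?_
    change _ = Complex.I * ((Real.cos θ : ℂ) + Real.sin θ * Complex.I)
    push_cast
    linear_combination -(Complex.sin θ) * Complex.I_sq
  have hψd : ∀ z, HasFDerivAt ψ (fderiv ℝ ψ z) z := fun z =>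
    (hψ.differentiable one_ne_zero z).hasFDerivAt
  have hDc : Continuous (fderiv ℝ ψ) := hψ.continuous_fderiv one_ne_zero
  obtain ⟨M, hM0, hM⟩ := hc.isCompact.isBounded.exists_pos_norm_lt
  have hψ0 : ∀ z : ℂ, M ≤ ‖z‖ → ψ z = 0 := fun z hz =>
    image_eq_zero_of_notMem_tsupport fun h => (hM z h).not_ge hz
  have hD0 : ∀ z : ℂ, M ≤ ‖z‖ → fderiv ℝ ψ z = 0 := fun z hz =>
    image_eq_zero_of_notMem_tsupport fun h => (hM z (tsupport_fderiv_subset ℝ h)).not_ge hz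
  let P : ℝ × ℝ → ℂ := fun p => fderiv ℝ ψ (p.1 * u p.2) (u p.2)
  let Q : ℝ × ℝ → ℂ := fun p => fderiv ℝ ψ (p.1 * u p.2) (Complex.I * u p.2)
  have hPc : Continuous P := by
    refine Continuous.clm_apply (hDc.comp ?_) (hu.comp continuous_snd); fun_prop
  have hQc : Continuous Q := by
    refine Continuous.clm_apply (hDc.comp ?_) (by fun_prop); fun_prop
  have hint : ∀ G : ℝ × ℝ → ℂ, Continuous G → (∀ p, M ≤ p.1 → G p = 0) →
      Integrable G ((volume.restrict (Set.Ioi 0)).prod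
        (volume.restrict (Set.Ioo (-Real.pi) Real.pi))) := by
    intro G hG hG0
    rw [Measure.prod_restrict]
    change IntegrableOn G _ (volume.prod volume)
    have hK : IntegrableOn G (Set.Icc 0 M ×ˢ Set.Icc (-Real.pi) Real.pi) (volume.prod volume) :=
      hG.continuousOn.integrableOn_compact (isCompact_Icc.prod isCompact_Icc)
    refine hK.of_forall_sdiff_eq_zero (measurableSet_Ioi.prod measurableSet_Ioo) ?_
    rintro ⟨ρ, θ⟩ ⟨⟨h1, h2⟩, h3⟩
    refine hG0 _ ?_
    by_contra! h4
    exact h3 ⟨⟨h1.le, h4.le⟩, ⟨h2.1.le, h2.2.le⟩⟩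
  have hnorm : ∀ (ρ θ : ℝ), M ≤ ρ → M ≤ ‖(ρ : ℂ) * u θ‖ := fun ρ θ h => by
    rw [norm_mul, hun, mul_one, Complex.norm_real]
    exact h.trans (le_abs_self _)
  have hPi := hint P hPc fun p hp => by simp only [P, hD0 _ (hnorm _ _ hp)]; rfl
  have hQi := hint Q hQc fun p hp => by simp only [Q, hD0 _ (hnorm _ _ hp)]; rfl
  have hP : ∀ θ, ∫ ρ in Set.Ioi (0 : ℝ), P (ρ, θ) = -ψ 0 := by
    intro θ
    have hd : ∀ ρ : ℝ, HasDerivAt (fun ρ : ℝ => ψ (ρ * u θ)) (P (ρ, θ)) ρ := by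
      intro ρ
      have h1 : HasDerivAt (fun ρ : ℝ => (ρ : ℂ) * u θ) (u θ) ρ := by
        simpa using (Complex.ofRealCLM.hasDerivAt (x := ρ)).mul_const (u θ)
      exact (hψd _).comp_hasDerivAt ρ h1
    have hic : Continuous fun ρ : ℝ => P (ρ, θ) := hPc.comp (by fun_prop)
    rw [integral_Ioi_of_hasDerivAt_of_tendsto' (f := fun ρ : ℝ => ψ (ρ * u θ)) (m := 0)
      (fun ρ _ => hd ρ)]
    · simp
    · have hK : IntegrableOn (fun ρ : ℝ => P (ρ, θ)) (Set.Icc 0 M) :=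
        hic.continuousOn.integrableOn_compact isCompact_Icc
      refine hK.of_forall_sdiff_eq_zero measurableSet_Ioi ?_
      rintro ρ ⟨h1, h3⟩
      have : M ≤ ρ := by
        by_contra! h4
        exact h3 ⟨(Set.mem_Ioi.1 h1).le, h4.le⟩
      simp only [P, hD0 _ (hnorm _ _ this)]; rfl
    · refine tendsto_const_nhds.congr' ?_
      filter_upwards [Filter.eventually_ge_atTop M] with ρ hρ
      exact (hψ0 _ (hnorm _ _ hρ)).symm
  have hQ : ∀ ρ, 0 < ρ → ∫ θ in Set.Ioo (-Real.pi) Real.pi, Q (ρ, θ) = 0 := by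
    intro ρ hρ
    have hd : ∀ θ : ℝ, HasDerivAt (fun θ : ℝ => ψ (ρ * u θ)) (ρ * Q (ρ, θ)) θ := by
      intro θ
      have h2 := (hψd _).comp_hasDerivAt θ ((hu' θ).const_mul (ρ : ℂ))
      refine h2.congr_deriv ?_
      change fderiv ℝ ψ (ρ * u θ) (ρ * (Complex.I * u θ)) =
        ρ * fderiv ℝ ψ (ρ * u θ) (Complex.I * u θ)
      rw [← Complex.real_smul, ← Complex.real_smul, map_smul]
      exact Complex.real_smul
    have hic : Continuous fun θ : ℝ => (ρ : ℂ) * Q (ρ, θ) :=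
      continuous_const.mul (hQc.comp (by fun_prop))
    have h1 := intervalIntegral.integral_eq_sub_of_hasDerivAt (a := -Real.pi) (b := Real.pi)
      (fun θ _ => hd θ) (hic.intervalIntegrable _ _)
    rw [intervalIntegral.integral_of_le (by linarith [Real.pi_pos]),
      integral_Ioc_eq_integral_Ioo, integral_const_mul] at h1
    have h2 : u Real.pi = u (-Real.pi) := by simp [u]
    rw [h2, sub_self] at h1
    exact (mul_eq_zero.1 h1).resolve_left (by exact_mod_cast hρ.ne')
  have hcongr : ∫ p in polarCoord.target, p.1 • ((Complex.polarCoord.symm p)⁻¹ *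
      dbar ψ 1 (Complex.polarCoord.symm p)) = ∫ p in polarCoord.target, (P p + Complex.I * Q p) := by
    refine setIntegral_congr_fun polarCoord.open_target.measurableSet ?_
    rintro ⟨ρ, θ⟩ ⟨hρ, -⟩
    have hρ' : (ρ : ℂ) ≠ 0 := by exact_mod_cast (Set.mem_Ioi.1 hρ).ne'
    have hinv : (u θ)⁻¹ = Real.cos θ - Real.sin θ * Complex.I := by
      refine inv_eq_of_mul_eq_one_right ?_
      have : (Real.cos θ : ℂ) ^ 2 + (Real.sin θ : ℂ) ^ 2 = 1 := by
        exact_mod_cast Real.cos_sq_add_sin_sq θ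
      simp only [u]
      linear_combination this - (Real.sin θ : ℂ) ^ 2 * Complex.I_sq
    have h3 := dbar_one_mul_eq (fderiv ℝ ψ (ρ * u θ)) (Real.cos θ) (Real.sin θ)
    simp only [Complex.polarCoord_symm_apply, P, Q, dbar]
    change ρ • (((ρ : ℂ) * u θ)⁻¹ * _) = _
    rw [mul_inv, hinv, Complex.real_smul, ← mul_assoc, ← mul_assoc, mul_inv_cancel₀ hρ', one_mul]
    simp only [smul_eq_mul, mul_one]
    exact h3.symm
  rw [hcongr, show polarCoord.target = Set.Ioi (0 : ℝ) ×ˢ Set.Ioo (-Real.pi) Real.pi from rfl,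
    Measure.volume_eq_prod, ← Measure.prod_restrict,
    integral_add hPi (hQi.const_mul _), integral_const_mul, integral_prod_symm _ hPi,
    integral_prod _ hQi]
  have h4 : ∫ ρ in Set.Ioi (0 : ℝ), ∫ θ in Set.Ioo (-Real.pi) Real.pi, Q (ρ, θ) = 0 := by
    rw [setIntegral_congr_fun measurableSet_Ioi fun ρ hρ => hQ ρ hρ]
    simp
  rw [h4]
  simp only [hP]
  rw [setIntegral_const]
  rw [Real.volume_real_Ioo_of_le (by linarith [Real.pi_pos]), Complex.real_smul]
  push_cast
  ring

/-! ### Solving the ∂̄-equation along parallel complex lines. -/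

/-- The Cauchy transform of `v` along the complex lines of direction `e`. -/
noncomputable def lineCauchyTransform {X : Type*} [NormedAddCommGroup X] [NormedSpace ℂ X]
    (e : X) (v : X → ℂ) (p : X) : ℂ :=
  ∫ t : ℂ, (2 * Real.pi * t)⁻¹ * v (p - t • e)

section

variable {X : Type*} [NormedAddCommGroup X] [NormedSpace ℂ X]
  {e : X} {A : X →L[ℝ] ℂ} {S : Set X} {R : ℝ} {v : X → ℂ}

theorem locallyIntegrable_cauchyKernel :
    LocallyIntegrable (fun t : ℂ => (2 * Real.pi * t)⁻¹) := by
  have : (fun t : ℂ => (2 * (Real.pi : ℂ) * t)⁻¹) = (2 * Real.pi : ℂ)⁻¹ • fun t : ℂ => t⁻¹ := by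
    ext t; simp [mul_comm]
  rw [this]
  exact locallyIntegrable_complex_inv.smul _

/-- `A` reads off the parameter on each line, so slices of `S` are bounded, locally uniformly in
`p`. This stands in for compactness of `S`. -/
theorem norm_le_of_sub_smul_mem (hA : ∀ t : ℂ, A (t • e) = t) (hR : ∀ q ∈ S, ‖A q‖ ≤ R)
    {p : X} {t : ℂ} (h : p - t • e ∈ S) : ‖t‖ ≤ ‖A p‖ + R := by
  have h1 := hR _ h
  rw [map_sub, hA] at h1
  have h2 : t = A p - (A p - t) := by ring
  calc ‖t‖ = ‖A p - (A p - t)‖ := by rw [← h2]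
    _ ≤ ‖A p‖ + ‖A p - t‖ := norm_sub_le _ _
    _ ≤ _ := by linarith

theorem fderiv_eq_zero_of_notMem (hS : IsClosed S) (hv : ∀ p ∉ S, v p = 0) {p : X} (hp : p ∉ S) :
    fderiv ℝ v p = 0 := by
  have : v =ᶠ[nhds p] fun _ => 0 := by
    filter_upwards [hS.isOpen_compl.mem_nhds hp] with q hq using hv q hq
  rw [this.fderiv_eq]; simp

theorem integrable_cauchyKernel_mul (hA : ∀ t : ℂ, A (t • e) = t) (hR : ∀ q ∈ S, ‖A q‖ ≤ R)
    (hv : Continuous v) (hv0 : ∀ p ∉ S, v p = 0) (p : X) :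
    Integrable fun t : ℂ => (2 * Real.pi * t)⁻¹ * v (p - t • e) := by
  have hc : HasCompactSupport fun t : ℂ => v (p - t • e) := by
    refine HasCompactSupport.intro (isCompact_closedBall (0 : ℂ) (‖A p‖ + R)) fun t ht => hv0 _ ?_
    intro h
    exact ht (by simpa using norm_le_of_sub_smul_mem hA hR h)
  have hc' : Continuous fun t : ℂ => v (p - t • e) := by fun_prop
  have := locallyIntegrable_cauchyKernel.integrable_smul_right_of_hasCompactSupport hc' hc
  simpa using this

/-- Differentiation under the integral: for base points within 1 of `p`, all integrands live on one
ball of radius `T`, where the kernel is integrable and `fderiv ℝ v` is bounded. -/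
theorem hasFDerivAt_lineCauchyTransform [FiniteDimensional ℂ X] (hA : ∀ t : ℂ, A (t • e) = t)
    (hS : IsClosed S) (hR : ∀ q ∈ S, ‖A q‖ ≤ R) (hv : ContDiff ℝ 1 v) (hv0 : ∀ p ∉ S, v p = 0)
    (p : X) :
    ∃ D : X →L[ℝ] ℂ, HasFDerivAt (lineCauchyTransform e v) D p ∧
      ∀ a, D a = ∫ t : ℂ, (2 * Real.pi * t)⁻¹ * fderiv ℝ v (p - t • e) a := by
  have : ProperSpace X := FiniteDimensional.proper ℂ X
  let k : ℂ → ℂ := fun t => (2 * Real.pi * t)⁻¹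
  have hkm : Measurable k := by fun_prop
  have hDc : Continuous (fderiv ℝ v) := hv.continuous_fderiv one_ne_zero
  obtain ⟨T, hT⟩ : ∃ T : ℝ, ∀ q ∈ Metric.closedBall p 1, ‖A q‖ + R ≤ T := by
    obtain ⟨T, hT⟩ := (isCompact_closedBall p 1).bddAbove_image
      (f := fun q => ‖A q‖ + R) (by fun_prop)
    exact ⟨T, fun q hq => hT ⟨q, hq, rfl⟩⟩
  obtain ⟨C, hC⟩ : ∃ C : ℝ, ∀ q ∈ Metric.closedBall p 1, ∀ t ∈ Metric.closedBall (0 : ℂ) T,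
      ‖fderiv ℝ v (q - t • e)‖ ≤ C := by
    obtain ⟨C, hC⟩ := ((isCompact_closedBall p 1).prod
      (isCompact_closedBall (0 : ℂ) T)).bddAbove_image
      (f := fun x : X × ℂ => ‖fderiv ℝ v (x.1 - x.2 • e)‖) (by fun_prop)
    exact ⟨C, fun q hq t ht => hC ⟨(q, t), ⟨hq, ht⟩, rfl⟩⟩
  let bound : ℂ → ℝ := (Metric.closedBall (0 : ℂ) T).indicator fun t => ‖k t‖ * C
  have hbound : Integrable bound := by
    refine (IntegrableOn.integrable_indicator ?_ measurableSet_closedBall)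
    exact ((locallyIntegrable_cauchyKernel.integrableOn_isCompact
      (isCompact_closedBall _ _)).norm).mul_const C
  have hle : ∀ q ∈ Metric.closedBall p 1, ∀ t : ℂ, ‖k t • fderiv ℝ v (q - t • e)‖ ≤ bound t := by
    intro q hq t
    by_cases ht : t ∈ Metric.closedBall (0 : ℂ) T
    · simp only [bound, Set.indicator_of_mem ht, norm_smul]
      exact mul_le_mul_of_nonneg_left (hC q hq t ht) (norm_nonneg _)
    · have : q - t • e ∉ S := fun h => ht (by
        simpa using (norm_le_of_sub_smul_mem hA hR h).trans (hT q hq))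
      rw [fderiv_eq_zero_of_notMem hS hv0 this]
      simp only [bound, Set.indicator_of_notMem ht]
      exact (norm_smul _ _).trans_le (by simp)
  have hF'm : AEStronglyMeasurable (fun t : ℂ => k t • fderiv ℝ v (p - t • e)) volume :=
    hkm.aestronglyMeasurable.smul (hDc.comp (by fun_prop)).aestronglyMeasurable
  have hF'i : Integrable (fun t : ℂ => k t • fderiv ℝ v (p - t • e)) :=
    hbound.mono' hF'm (Filter.Eventually.of_forall fun t =>
      hle p (Metric.mem_closedBall_self zero_le_one) t)
  refine ⟨∫ t : ℂ, k t • fderiv ℝ v (p - t • e), ?_, fun a => ?_⟩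
  · refine hasFDerivAt_integral_of_dominated_of_fderiv_le (𝕜 := ℝ)
      (F' := fun q t => k t • fderiv ℝ v (q - t • e))
      (Metric.closedBall_mem_nhds p one_pos) ?_ ?_ hF'm
      (Filter.Eventually.of_forall fun t q hq => hle q hq t) hbound ?_
    · refine Filter.Eventually.of_forall fun q => ?_
      exact hkm.aestronglyMeasurable.mul (hv.continuous.comp (by fun_prop)).aestronglyMeasurable
    · exact integrable_cauchyKernel_mul hA hR hv.continuous hv0 p
    · refine Filter.Eventually.of_forall fun t q _ => ?_
      have h1 : HasFDerivAt (fun q => v (q - t • e)) (fderiv ℝ v (q - t • e)) q := by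
        have := ((hv.differentiable one_ne_zero (q - t • e)).hasFDerivAt).comp q
          ((hasFDerivAt_id q).sub_const (t • e))
        simpa [Function.comp_def] using this
      exact h1.const_mul (k t)
  · rw [ContinuousLinearMap.integral_apply hF'i]
    rfl

theorem dbar_lineCauchyTransform [FiniteDimensional ℂ X] (hA : ∀ t : ℂ, A (t • e) = t)
    (hS : IsClosed S) (hR : ∀ q ∈ S, ‖A q‖ ≤ R) (hv : ContDiff ℝ 1 v) (hv0 : ∀ p ∉ S, v p = 0)
    (a p : X) :
    dbar (lineCauchyTransform e v) a p = lineCauchyTransform e (dbar v a) p := by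
  obtain ⟨D, hD, hDa⟩ := hasFDerivAt_lineCauchyTransform hA hS hR hv hv0 p
  have hi : ∀ b : X, Integrable fun t : ℂ => (2 * Real.pi * t)⁻¹ * fderiv ℝ v (p - t • e) b :=
    fun b => integrable_cauchyKernel_mul (v := fun q => fderiv ℝ v q b) hA hR
      ((hv.continuous_fderiv one_ne_zero).clm_apply continuous_const)
      (fun q hq => by simp [fderiv_eq_zero_of_notMem hS hv0 hq]) p
  rw [dbar, hD.fderiv, hDa, hDa, ← integral_const_mul, ← integral_add (hi _) ((hi _).const_mul _)]
  simp only [lineCauchyTransform, dbar]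
  congr 1
  ext t
  ring

/-- Cauchy–Pompeiu for `t ↦ v (p - t • e)`; the reversed direction absorbs the minus sign of that
formula. -/
theorem lineCauchyTransform_dbar (hA : ∀ t : ℂ, A (t • e) = t)
    (hR : ∀ q ∈ S, ‖A q‖ ≤ R) (hv : ContDiff ℝ 1 v) (hv0 : ∀ p ∉ S, v p = 0)
    (p : X) : lineCauchyTransform e (dbar v e) p = v p := by
  let ψ : ℂ → ℂ := fun t => v (p - t • e)
  have hψ : ContDiff ℝ 1 ψ := by fun_prop
  have hc : HasCompactSupport ψ := by
    refine HasCompactSupport.intro (isCompact_closedBall (0 : ℂ) (‖A p‖ + R)) fun t ht => hv0 _ ?_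
    intro h
    exact ht (by simpa using norm_le_of_sub_smul_mem hA hR h)
  have hd : ∀ t, dbar ψ 1 t = -dbar v e (p - t • e) := by
    intro t
    have h1 : HasFDerivAt (fun t : ℂ => p - t • e)
        (-((ContinuousLinearMap.id ℝ ℂ).smulRight e)) t :=
      ((ContinuousLinearMap.id ℝ ℂ).smulRight e).hasFDerivAt.const_sub p
    have h2 := ((hv.differentiable one_ne_zero (p - t • e)).hasFDerivAt).comp t h1
    change HasFDerivAt ψ _ t at h2
    rw [dbar, h2.fderiv, dbar]
    simp
    ring
  have key := integral_inv_mul_dbar hψ hc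
  simp only [hd, ψ, zero_smul, sub_zero] at key
  have : ∀ t : ℂ, (2 * Real.pi * t)⁻¹ * dbar v e (p - t • e) =
      -(2 * Real.pi : ℂ)⁻¹ * (t⁻¹ * -dbar v e (p - t • e)) := fun t => by
    rw [mul_inv]; ring
  simp only [lineCauchyTransform, this]
  rw [integral_const_mul, key]
  have hpi : (Real.pi : ℂ) ≠ 0 := by exact_mod_cast Real.pi_ne_zero
  field_simp

end

/-! ### A cutoff with globally bounded gradient. -/

/-- One minus a mollified indicator of the `r / 2`-neighbourhood. Since `E` may be unbounded, the
gradient bound comes from the L¹ norm of the derivative of the mollifier. -/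
theorem exists_contDiff_cutoff {X : Type*} [NormedAddCommGroup X] [NormedSpace ℝ X]
    [FiniteDimensional ℝ X] (E : Set X) {r : ℝ} (hr : 0 < r) :
    ∃ χ : X → ℝ, ContDiff ℝ 2 χ ∧ (∃ C, ∀ p, ‖fderiv ℝ χ p‖ ≤ C) ∧
      (∀ p ∈ Metric.thickening (r / 4) E, χ p = 0) ∧
      ∀ p ∉ Metric.cthickening (3 * r / 4) E, χ p = 1 := by
  let : MeasurableSpace X := borel X
  have : BorelSpace X := ⟨rfl⟩
  let μ : Measure X := Measure.addHaar
  let ρ : ContDiffBump (0 : X) := ⟨r / 8, r / 4, by positivity, by linarith⟩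
  let U := Metric.thickening (r / 2) E
  let g : X → ℝ := U.indicator 1
  have hU : MeasurableSet U := Metric.isOpen_thickening.measurableSet
  have hg : LocallyIntegrable g μ :=
    (locallyIntegrable_const (1 : ℝ)).indicator hU
  have hρ : ContDiff ℝ 2 (ρ.normed μ) := ρ.contDiff_normed
  have hρc : HasCompactSupport (ρ.normed μ) := ρ.hasCompactSupport_normed
  let L := ContinuousLinearMap.lsmul ℝ ℝ (E := ℝ)
  let h : X → ℝ := convolution (ρ.normed μ) g L μ
  have hconst : ∀ p c, (∀ q ∈ Metric.ball p (r / 4), g q = c) → h p = c := by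
    intro p c hc
    have hp := hc p (Metric.mem_ball_self (by positivity))
    rw [← hp]
    exact ρ.normed_convolution_eq_right fun q hq => by rw [hc q hq, hp]
  refine ⟨fun p => 1 - h p, contDiff_const.sub (hρc.contDiff_convolution_left L hρ hg), ?_, ?_, ?_⟩
  · refine ⟨∫ x, ‖fderiv ℝ (ρ.normed μ) x‖ ∂μ, fun p => ?_⟩
    have h1 := hρc.hasFDerivAt_convolution_left L (hρ.of_le one_le_two) hg p
    rw [(h1.const_sub 1).fderiv, norm_neg, convolution_def]
    refine norm_integral_le_of_norm_le ?_ (Filter.Eventually.of_forall fun t => ?_)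
    · exact ((hρ.continuous_fderiv two_ne_zero).integrable_of_hasCompactSupport
        (hρc.fderiv ℝ)).norm
    · refine ContinuousLinearMap.opNorm_le_bound _ (norm_nonneg _) fun x => ?_
      have h2 : L.precompL X (fderiv ℝ (ρ.normed μ) t) (g (p - t)) x =
        fderiv ℝ (ρ.normed μ) t x * g (p - t) := rfl
      have h3 : ‖g (p - t)‖ ≤ 1 := by
        simpa using norm_indicator_le_norm_self (s := U) (1 : X → ℝ) (p - t)
      rw [h2, norm_mul]
      exact (mul_le_of_le_one_right (norm_nonneg _) h3).trans (ContinuousLinearMap.le_opNorm _ _)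
  · intro p hp
    change 1 - h p = 0
    rw [hconst p 1, sub_self]
    intro q hq
    refine Set.indicator_of_mem ?_ _
    obtain ⟨z, hz, hpz⟩ := Metric.mem_thickening_iff.1 hp
    refine Metric.mem_thickening_iff.2 ⟨z, hz, ?_⟩
    have := dist_triangle q p z
    have := Metric.mem_ball.1 hq
    linarith
  · intro p hp
    change 1 - h p = 1
    rw [hconst p 0, sub_zero]
    intro q hq
    refine Set.indicator_of_notMem (fun h => hp ?_) _
    obtain ⟨z, hz, hqz⟩ := Metric.mem_thickening_iff.1 h
    refine Metric.mem_cthickening_of_dist_le p z _ _ hz ?_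
    have := dist_triangle p q z
    have := Metric.mem_ball'.1 hq
    linarith

/-! ### The L² bound for the Cauchy transform. -/

open scoped ENNReal in
theorem lintegral_sq_lintegral_mul_translate_le {X : Type*} [NormedAddCommGroup X] [NormedSpace ℂ X]
    [MeasurableSpace X] [BorelSpace X] [SecondCountableTopology X] (μ : Measure X) [SFinite μ]
    [μ.IsAddRightInvariant]
    {k : ℂ → ℝ≥0∞} (hk : Measurable k) {w : X → ℝ≥0∞} (hw : Measurable w) (e : X) :
    ∫⁻ p, (∫⁻ t, k t * w (p - t • e)) ^ 2 ∂μ ≤ (∫⁻ t, k t) ^ 2 * ∫⁻ p, w p ^ 2 ∂μ := by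
  have hk2 : Measurable fun t => k t ^ (1 / 2 : ℝ) := hk.pow_const _
  have hsq : ∀ x : ℝ≥0∞, (x ^ (1 / 2 : ℝ)) ^ (2 : ℝ) = x := fun x => by
    rw [← ENNReal.rpow_mul]; norm_num
  -- Cauchy–Schwarz with `k` split as `k ^ (1/2) * k ^ (1/2)`; Tonelli and translation invariance
  -- then finish.
  have hCS : ∀ p, (∫⁻ t, k t * w (p - t • e)) ^ 2 ≤
      (∫⁻ t, k t) * ∫⁻ t, k t * w (p - t • e) ^ 2 := by
    intro p
    have hwp : Measurable fun t : ℂ => w (p - t • e) := hw.comp (by fun_prop)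
    have h1 := ENNReal.lintegral_mul_le_Lp_mul_Lq volume Real.HolderConjugate.two_two
      hk2.aemeasurable (hk2.mul hwp).aemeasurable
    have h2 : ∀ t, k t ^ (1 / 2 : ℝ) * (k t ^ (1 / 2 : ℝ) * w (p - t • e)) =
        k t * w (p - t • e) := fun t => by
      rw [← mul_assoc, ← pow_two, ← ENNReal.rpow_ofNat, hsq]
    simp only [Pi.mul_apply, h2, ENNReal.mul_rpow_of_nonneg _ _ zero_le_two, hsq] at h1
    calc _ ≤ ((∫⁻ t, k t) ^ (1 / 2 : ℝ) *
          (∫⁻ t, k t * w (p - t • e) ^ (2 : ℝ)) ^ (1 / 2 : ℝ)) ^ 2 := by gcongr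
      _ = _ := by
        rw [← ENNReal.rpow_ofNat, ENNReal.mul_rpow_of_nonneg _ _ zero_le_two, hsq, hsq]
        simp only [ENNReal.rpow_ofNat]
  calc ∫⁻ p, (∫⁻ t, k t * w (p - t • e)) ^ 2 ∂μ
      ≤ ∫⁻ p, (∫⁻ t, k t) * (∫⁻ t, k t * w (p - t • e) ^ 2) ∂μ := lintegral_mono hCS
    _ = (∫⁻ t, k t) * ∫⁻ p, (∫⁻ t : ℂ, k t * w (p - t • e) ^ 2) ∂μ := by
        refine lintegral_const_mul _ (Measurable.lintegral_prod_right ?_)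
        fun_prop
    _ = (∫⁻ t, k t) * ∫⁻ t, (∫⁻ p, k t * w (p - t • e) ^ 2 ∂μ) := by
        rw [lintegral_lintegral_swap]
        exact Measurable.aemeasurable (by fun_prop)
    _ = (∫⁻ t, k t) * ∫⁻ t, k t * (∫⁻ p, w p ^ 2 ∂μ) := by
        congr 2 with t
        rw [lintegral_const_mul _ (by fun_prop),
          lintegral_sub_right_eq_self (fun p => w p ^ 2) (t • e)]
    _ = _ := by
        rw [lintegral_mul_const _ hk, pow_two, mul_assoc]

theorem memLp_two_lineCauchyTransform {X : Type*} [NormedAddCommGroup X] [NormedSpace ℂ X]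
    [MeasurableSpace X] [BorelSpace X] [SecondCountableTopology X] {μ : Measure X} [SFinite μ]
    [μ.IsAddRightInvariant] {e : X} {A : X →L[ℝ] ℂ} {S : Set X} {R : ℝ} {v : X → ℂ}
    (hA : ∀ t : ℂ, A (t • e) = t) (hR : ∀ q ∈ S, ‖A q‖ ≤ R) (hv : Continuous v)
    (hv0 : ∀ p ∉ S, v p = 0) (hv2 : MemLp v 2 μ) {K : Set X} (hK : MeasurableSet K) (hKS : K ⊆ S)
    (hu : Continuous (lineCauchyTransform e v)) :
    MemLp (lineCauchyTransform e v) 2 (μ.restrict K) := by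
  refine ⟨hu.aestronglyMeasurable, ?_⟩
  -- If `p` and `p - t • e` both lie in `S`, then `‖t‖ ≤ R + R`, so for `p ∈ K` the kernel may be
  -- truncated to this ball.
  let k : ℂ → ENNReal := (Metric.closedBall (0 : ℂ) (R + R)).indicator
    fun t => ‖(2 * Real.pi * t : ℂ)⁻¹‖ₑ
  have hk : Measurable k := Measurable.indicator (by fun_prop) measurableSet_closedBall
  have hkfin : ∫⁻ t, k t < ⊤ := by
    rw [lintegral_indicator measurableSet_closedBall]
    exact (locallyIntegrable_cauchyKernel.integrableOn_isCompact (isCompact_closedBall _ _)).2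
  have hv2' : ∫⁻ p, ‖v p‖ₑ ^ 2 ∂μ < ⊤ := by
    simpa using (eLpNorm_lt_top_iff_lintegral_rpow_enorm_lt_top two_ne_zero (by simp)).1 hv2.2
  rw [eLpNorm_lt_top_iff_lintegral_rpow_enorm_lt_top two_ne_zero (by simp)]
  simp only [ENNReal.toReal_ofNat, ENNReal.rpow_ofNat]
  calc ∫⁻ p in K, ‖lineCauchyTransform e v p‖ₑ ^ 2 ∂μ
      ≤ ∫⁻ p in K, (∫⁻ t, k t * ‖v (p - t • e)‖ₑ) ^ 2 ∂μ := by
        refine setLIntegral_mono' hK fun p hp => ?_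
        gcongr
        refine (enorm_integral_le_lintegral_enorm _).trans (lintegral_mono fun t => ?_)
        rw [enorm_mul]
        by_cases ht : p - t • e ∈ S
        · have h1 := norm_le_of_sub_smul_mem hA hR ht
          have h2 := hR p (hKS hp)
          have h3 : t ∈ Metric.closedBall (0 : ℂ) (R + R) := by
            simpa using h1.trans (by linarith)
          simp [k, Set.indicator_of_mem h3]
        · simp [hv0 _ ht]
    _ ≤ ∫⁻ p, (∫⁻ t, k t * ‖v (p - t • e)‖ₑ) ^ 2 ∂μ := setLIntegral_le_lintegral _ _
    _ ≤ (∫⁻ t, k t) ^ 2 * ∫⁻ p, ‖v p‖ₑ ^ 2 ∂μ :=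
        lintegral_sq_lintegral_mul_translate_le μ hk hv.enorm.measurable e
    _ < ⊤ := ENNReal.mul_lt_top (ENNReal.pow_lt_top hkfin) hv2'

/-! ### Calculus of `dbar`. -/

section dbar

variable {X : Type*} [NormedAddCommGroup X] [NormedSpace ℂ X] {f g : X → ℂ} {p : X}

theorem Filter.EventuallyEq.dbar_eq (h : f =ᶠ[nhds p] g) (a : X) : dbar f a p = dbar g a p := by
  simp only [dbar, h.fderiv_eq]

theorem dbar_const (z : ℂ) (a : X) : dbar (fun _ : X => z) a p = 0 := by
  simp [dbar]

theorem dbar_sub (hf : DifferentiableAt ℝ f p) (hg : DifferentiableAt ℝ g p) (a : X) :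
    dbar (fun q => f q - g q) a p = dbar f a p - dbar g a p := by
  simp only [dbar, fderiv_fun_sub hf hg, sub_apply]
  ring

theorem dbar_mul (hf : DifferentiableAt ℝ f p) (hg : DifferentiableAt ℝ g p) (a : X) :
    dbar (fun q => f q * g q) a p = f p * dbar g a p + g p * dbar f a p := by
  simp only [dbar, fderiv_fun_mul hf hg, add_apply,
    smul_apply, smul_eq_mul]
  ring

theorem dbar_eq_zero_of_differentiableAt (hf : DifferentiableAt ℂ f p) (a : X) :
    dbar f a p = 0 := by
  rw [dbar, (hf.hasFDerivAt.restrictScalars ℝ).fderiv]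
  simp only [ContinuousLinearMap.coe_restrictScalars', map_smul, smul_eq_mul]
  linear_combination (fderiv ℂ f p a) * Complex.I_sq

theorem differentiableAt_of_dbar_eq_zero (hf : DifferentiableAt ℝ f p)
    (h : ∀ a, dbar f a p = 0) : DifferentiableAt ℂ f p := by
  have hI : ∀ a, fderiv ℝ f p (Complex.I • a) = Complex.I * fderiv ℝ f p a := fun a => by
    have := h a
    rw [dbar] at this
    linear_combination -Complex.I * this + fderiv ℝ f p (Complex.I • a) * Complex.I_sq
  let D : X →L[ℂ] ℂ :=
    { toFun := fderiv ℝ f p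
      map_add' := map_add _
      map_smul' := fun z a => by
        have : z • a = z.re • a + z.im • (Complex.I • a) := by
          conv_lhs => rw [← Complex.re_add_im z]
          rw [add_smul, mul_smul]
          simp only [Complex.coe_smul]
        rw [this, map_add, map_smul, map_smul, hI]
        simp only [Complex.real_smul, RingHom.id_apply, smul_eq_mul]
        conv_rhs => rw [← Complex.re_add_im z]
        ring
      cont := (fderiv ℝ f p).continuous }
  exact (hasFDerivAt_of_restrictScalars ℝ (f' := D) hf.hasFDerivAt rfl).differentiableAt

theorem ContDiff.dbar (hf : ContDiff ℝ 2 f) (a : X) : ContDiff ℝ 1 (dbar f a) := by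
  have : ContDiff ℝ 1 (fderiv ℝ f) := hf.fderiv_right (by norm_num)
  unfold _root_.dbar
  fun_prop

theorem dbar_dbar_comm (hf : ContDiff ℝ 2 f) (a b : X) :
    dbar (dbar f a) b p = dbar (dbar f b) a p := by
  have hd : DifferentiableAt ℝ (fderiv ℝ f) p :=
    (hf.fderiv_right (m := 1) (by norm_num)).differentiable one_ne_zero p
  have h1 : ∀ a b, fderiv ℝ (dbar f a) p b =
      fderiv ℝ (fderiv ℝ f) p b a + Complex.I * fderiv ℝ (fderiv ℝ f) p b (Complex.I • a) := by
    intro a b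
    have h2 : ∀ c : X, HasFDerivAt (fun q => fderiv ℝ f q c)
        ((fderiv ℝ (fderiv ℝ f) p).flip c) p := fun c => by
      simpa using hd.hasFDerivAt.clm_apply (hasFDerivAt_const c p)
    have h3 := (h2 a).add ((h2 (Complex.I • a)).const_mul Complex.I)
    change HasFDerivAt (dbar f a) _ p at h3
    rw [h3.fderiv]
    simp
  have hs : IsSymmSndFDerivAt ℝ f p := hf.contDiffAt.isSymmSndFDerivAt (by simp)
  rw [dbar, dbar, h1, h1, h1, h1, hs.eq b a, hs.eq b (Complex.I • a), hs.eq (Complex.I • b) a,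
    hs.eq (Complex.I • b) (Complex.I • a)]
  ring

theorem norm_dbar_le {C : ℝ} (h : ‖fderiv ℝ f p‖ ≤ C) (a : X) : ‖dbar f a p‖ ≤ 2 * C * ‖a‖ := by
  have h1 : ∀ b, ‖fderiv ℝ f p b‖ ≤ C * ‖b‖ := fun b =>
    (ContinuousLinearMap.le_opNorm _ _).trans (by gcongr)
  have h2 := h1 (Complex.I • a)
  rw [norm_smul, Complex.norm_I, one_mul] at h2
  calc _ ≤ ‖fderiv ℝ f p a‖ + ‖Complex.I * fderiv ℝ f p (Complex.I • a)‖ := norm_add_le _ _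
    _ ≤ _ := by rw [norm_mul, Complex.norm_I, one_mul]; linarith [h1 a]

end dbar

/-! ### The ∂̄-closed form and the extension. -/

/-- Off `Ω \ E` the cutoff is locally constant, so the uncontrolled values of `f` there are
multiplied by 0. The right side is symmetric in `a` and `b`, which makes the form closed. -/
theorem dbar_mul_dbar {X : Type*} [NormedAddCommGroup X] [NormedSpace ℂ X] {Ω E : Set X}
    {f c : X → ℂ} (hΩ : IsOpen Ω) (hE : IsClosed E)
    (hf : DifferentiableOn ℂ f (Ω \ E)) (hc : ContDiff ℝ 2 c)
    (hc0 : ∀ p ∉ Ω \ E, ∃ z, c =ᶠ[nhds p] fun _ => z) (a b p : X) :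
    dbar (fun p => f p * dbar c a p) b p = f p * dbar (dbar c a) b p := by
  by_cases hp : p ∈ Ω \ E
  · have hfp : DifferentiableAt ℂ f p := hf.differentiableAt ((hΩ.sdiff hE).mem_nhds hp)
    rw [dbar_mul (hfp.restrictScalars ℝ) ((hc.dbar a).differentiable one_ne_zero p),
      dbar_eq_zero_of_differentiableAt hfp, mul_zero, add_zero]
  · obtain ⟨z, hz⟩ := hc0 p hp
    have h1 : dbar c a =ᶠ[nhds p] fun _ => 0 := by
      filter_upwards [hz.eventuallyEq_nhds] with q hq
      rw [Filter.EventuallyEq.dbar_eq hq, dbar_const]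
    have h2 : (fun p => f p * dbar c a p) =ᶠ[nhds p] fun _ => 0 := by
      filter_upwards [h1] with q hq
      rw [hq, mul_zero]
    rw [h1.dbar_eq, h2.dbar_eq]
    simp only [dbar_const, mul_zero]

/-- The set `Z` of points of `Sᶜ` with zero germ is open, and closed in `Sᶜ` by the identity
theorem. If it missed `Ω`, a neighbourhood of `S`, it would be closed in `X`, hence all of `X`,
although `S` is nonempty. -/
theorem exists_mem_eventuallyEq_zero {X : Type*} [NormedAddCommGroup X]
    [NormedSpace ℂ X] {Ω S : Set X} {u : X → ℂ} (hΩ : IsOpen Ω)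
    (hSΩ : S ⊆ Ω) (hS : IsClosed S) (hSne : S.Nonempty) (hu : DifferentiableOn ℂ u Sᶜ)
    (h0 : ∃ p ∉ S, u =ᶠ[nhds p] 0) : ∃ p ∈ Ω \ S, u =ᶠ[nhds p] 0 := by
  let Z : Set X := Sᶜ ∩ {p | u =ᶠ[nhds p] 0}
  have hZo : IsOpen Z := hS.isOpen_compl.inter isOpen_setOfPred_eventually_nhds
  by_contra! hcon
  have hZc : IsClosed Z := by
    refine isClosed_of_closure_subset fun z hz => ?_
    have hzS : z ∈ Sᶜ := fun hzS => by
      obtain ⟨w, hwΩ, hw⟩ := mem_closure_iff.1 hz Ω hΩ (hSΩ hzS)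
      exact hcon w ⟨hwΩ, hw.1⟩ hw.2
    refine ⟨hzS, ?_⟩
    obtain ⟨ε, hε, hb⟩ := Metric.isOpen_iff.1 hS.isOpen_compl z hzS
    obtain ⟨w, hw, hwz⟩ := Metric.mem_closure_iff.1 hz ε hε
    have hwb : w ∈ Metric.ball z ε := by rwa [Metric.mem_ball, dist_comm]
    filter_upwards [Metric.ball_mem_nhds z hε] with y hy
    exact eq_zero_of_eventuallyEq_zero_of_convex Metric.isOpen_ball (convex_ball z ε) (hu.mono hb)
      hwb hy hw.2
  obtain ⟨p, hpS, hp⟩ := h0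
  have huniv : Z = Set.univ := IsClopen.eq_univ ⟨hZc, hZo⟩ ⟨p, hpS, hp⟩
  obtain ⟨s, hs⟩ := hSne
  exact (huniv ▸ Set.mem_univ s : s ∈ Z).1 hs

section

variable {X : Type*} [NormedAddCommGroup X] [NormedSpace ℂ X] [FiniteDimensional ℂ X]
  {Ω E S : Set X} {f c : X → ℂ}

theorem contDiff_mul_dbar (hΩ : IsOpen Ω) (hE : IsClosed E)
    (hf : DifferentiableOn ℂ f (Ω \ E)) (hc : ContDiff ℝ 2 c)
    (hc0 : ∀ p ∉ Ω \ E, ∃ z, c =ᶠ[nhds p] fun _ => z) (a : X) :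
    ContDiff ℝ 1 (fun p => f p * dbar c a p) := by
  rw [contDiff_iff_contDiffAt]
  intro p
  by_cases hp : p ∈ Ω \ E
  · have hfC := (contDiffOn_one_of_differentiableOn_complex (hΩ.sdiff hE) hf).contDiffAt
      ((hΩ.sdiff hE).mem_nhds hp)
    exact (hfC.restrict_scalars ℝ).mul (hc.dbar a).contDiffAt
  · obtain ⟨z, hz⟩ := hc0 p hp
    have : (fun p => f p * dbar c a p) =ᶠ[nhds p] fun _ => 0 := by
      filter_upwards [hz.eventuallyEq_nhds] with q hq
      rw [Filter.EventuallyEq.dbar_eq hq, dbar_const, mul_zero]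
    exact contDiffAt_const.congr_of_eventuallyEq this

theorem differentiable_lineCauchyTransform {e : X} {A : X →L[ℝ] ℂ} {R : ℝ}
    (hA : ∀ t : ℂ, A (t • e) = t) (hS : IsClosed S) (hR : ∀ q ∈ S, ‖A q‖ ≤ R) {v : X → ℂ}
    (hv : ContDiff ℝ 1 v) (hv0 : ∀ p ∉ S, v p = 0) :
    Differentiable ℝ (lineCauchyTransform e v) := fun p =>
  let ⟨_, hD, _⟩ := hasFDerivAt_lineCauchyTransform hA hS hR hv hv0 p
  hD.differentiableAt

theorem exists_holomorphic_extension_of_bounded_slices [MeasurableSpace X] [BorelSpace X]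
    (μ : Measure X) [μ.IsAddHaarMeasure] (hΩ : IsOpen Ω) (hE : IsClosed E) (hEne : E.Nonempty)
    {r : ℝ} (hr : 0 < r) (hrΩ : Metric.cthickening r E ⊆ Ω) {e : X} {A : X →L[ℝ] ℂ}
    (hA : ∀ t : ℂ, A (t • e) = t) {R : ℝ} (hR : ∀ q ∈ E, ‖A q‖ ≤ R) {m : X →L[ℝ] ℝ} (hm : m ≠ 0)
    (hme : ∀ t : ℂ, m (t • e) = 0) {M : ℝ} (hM : ∀ q ∈ E, m q ≤ M)
    (hconn : IsPreconnected (Ω \ E)) (hf : DifferentiableOn ℂ f (Ω \ E))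
    (hf2 : MemLp f 2 (μ.restrict (Ω \ E))) :
    ∃ F : X → ℂ, DifferentiableOn ℂ F Ω ∧ MemLp F 2 (μ.restrict Ω) ∧ Set.EqOn F f (Ω \ E) := by
  have : ProperSpace X := FiniteDimensional.proper ℂ X
  have : FiniteDimensional ℝ X := FiniteDimensional.complexToReal X
  obtain ⟨χ, hχ, ⟨C, hC⟩, hχ0, hχ1⟩ := exists_contDiff_cutoff E hr
  set S := Metric.cthickening (3 * r / 4) E
  have hS : IsClosed S := Metric.isClosed_cthickening
  have hSΩ : S ⊆ Ω := (Metric.cthickening_mono (by linarith) E).trans hrΩ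
  have hES : E ⊆ S := Metric.self_subset_cthickening E
  have hSE : ∀ q ∈ S, ∃ z ∈ E, ‖q - z‖ ≤ r := fun q hq => by
    obtain ⟨z, hz, hqz⟩ := Metric.mem_thickening_iff.1
      (Metric.cthickening_subset_thickening' hr (by linarith : 3 * r / 4 < r) E hq)
    exact ⟨z, hz, by rw [← dist_eq_norm]; exact hqz.le⟩
  have hRS : ∀ q ∈ S, ‖A q‖ ≤ R + ‖A‖ * r := fun q hq => by
    obtain ⟨z, hz, hqz⟩ := hSE q hq
    calc ‖A q‖ = ‖A z + A (q - z)‖ := by rw [← map_add, add_sub_cancel]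
      _ ≤ ‖A z‖ + ‖A‖ * ‖q - z‖ := (norm_add_le _ _).trans (by gcongr; exact A.le_opNorm _)
      _ ≤ _ := by gcongr; exact hR z hz
  have hMS : ∀ q ∈ S, m q ≤ M + ‖m‖ * r := fun q hq => by
    obtain ⟨z, hz, hqz⟩ := hSE q hq
    calc m q = m z + m (q - z) := by rw [← map_add, add_sub_cancel]
      _ ≤ m z + ‖m‖ * ‖q - z‖ := by gcongr; exact (le_abs_self _).trans (m.le_opNorm _)
      _ ≤ _ := by gcongr; exact hM z hz
  let c : X → ℂ := fun p => (χ p : ℂ)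
  have hc : ContDiff ℝ 2 c := Complex.ofRealCLM.contDiff.comp hχ
  have hcE : ∀ p ∈ E, c =ᶠ[nhds p] fun _ => 0 := fun p hp => by
    filter_upwards [Metric.isOpen_thickening.mem_nhds
      (Metric.self_subset_thickening (by positivity : 0 < r / 4) E hp)] with q hq
    simp [c, hχ0 q hq]
  have hcS : ∀ p ∉ S, c =ᶠ[nhds p] fun _ => 1 := fun p hp => by
    filter_upwards [hS.isOpen_compl.mem_nhds hp] with q hq
    simp [c, hχ1 q hq]
  have hc0 : ∀ p ∉ Ω \ E, ∃ z, c =ᶠ[nhds p] fun _ => z := fun p hp => by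
    by_cases hpE : p ∈ E
    · exact ⟨0, hcE p hpE⟩
    · exact ⟨1, hcS p fun hpS => hp ⟨hSΩ hpS, hpE⟩⟩
  have hdc0 : ∀ p ∉ Ω \ E, ∀ a, dbar c a p = 0 := fun p hp a => by
    obtain ⟨z, hz⟩ := hc0 p hp
    rw [hz.dbar_eq, dbar_const]
  let v : X → X → ℂ := fun a p => f p * dbar c a p
  have hv : ∀ a, ContDiff ℝ 1 (v a) := contDiff_mul_dbar hΩ hE hf hc hc0
  have hv0 : ∀ a, ∀ p ∉ S, v a p = 0 := fun a p hp => by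
    simp only [v, (hcS p hp).dbar_eq, dbar_const, mul_zero]
  have hvsymm : ∀ a b, dbar (v a) b = dbar (v b) a := fun a b => by
    ext p
    rw [dbar_mul_dbar hΩ hE hf hc hc0, dbar_mul_dbar hΩ hE hf hc hc0, dbar_dbar_comm hc]
  let u : X → ℂ := lineCauchyTransform e (v e)
  have hud : Differentiable ℝ u := differentiable_lineCauchyTransform hA hS hRS (hv e) (hv0 e)
  -- Closedness trades the derivative of `v e` along `a` for that of `v a` along `e`, which the
  -- transform inverts.
  have hu : ∀ a p, dbar u a p = v a p := fun a p => by
    rw [dbar_lineCauchyTransform hA hS hRS (hv e) (hv0 e), hvsymm,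
      lineCauchyTransform_dbar hA hRS (hv a) (hv0 a)]
  have huS : DifferentiableOn ℂ u Sᶜ := fun p hp =>
    (differentiableAt_of_dbar_eq_zero (hud p) fun a => by
      rw [hu, hv0 a p hp]).differentiableWithinAt
  -- `m` is constant on lines parallel to `e`, so lines where it exceeds its bound on `S` never meet
  -- the support of `v e`.
  have hu0 : ∃ p ∉ S, u =ᶠ[nhds p] 0 := by
    have hW : IsOpen {p : X | M + ‖m‖ * r < m p} := isOpen_lt continuous_const m.continuous
    have huW : ∀ p, M + ‖m‖ * r < m p → u p = 0 := fun p hp => by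
      have : ∀ t : ℂ, (2 * Real.pi * t)⁻¹ * v e (p - t • e) = 0 := fun t => by
        rw [hv0 e _ fun h => ?_, mul_zero]
        have := hMS _ h
        rw [map_sub, hme, sub_zero] at this
        linarith
      simp only [u, lineCauchyTransform, this, integral_zero]
    obtain ⟨x, hx⟩ : ∃ x, m x ≠ 0 := by
      by_contra! h
      exact hm (ContinuousLinearMap.ext h)
    let p : X := ((M + ‖m‖ * r + 1) / m x) • x
    have hp : M + ‖m‖ * r < m p := by
      simp only [p, map_smul, smul_eq_mul, div_mul_cancel₀ _ hx]
      linarith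
    refine ⟨p, fun h => (hMS p h).not_gt hp, ?_⟩
    filter_upwards [hW.mem_nhds hp] with q hq using huW q hq
  have hcf : ∀ p ∈ Ω, DifferentiableAt ℝ (fun q => f q * c q) p ∧
      ∀ a, dbar (fun q => f q * c q) a p = v a p := fun p hp => by
    by_cases hpE : p ∈ E
    · have h1 : (fun q => f q * c q) =ᶠ[nhds p] fun _ => 0 := by
        filter_upwards [hcE p hpE] with q hq
        rw [hq, mul_zero]
      refine ⟨(differentiableAt_const 0).congr_of_eventuallyEq h1, fun a => ?_⟩
      rw [h1.dbar_eq, dbar_const]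
      simp only [v, hdc0 p (fun h => h.2 hpE), mul_zero]
    · have hfp : DifferentiableAt ℂ f p := hf.differentiableAt ((hΩ.sdiff hE).mem_nhds ⟨hp, hpE⟩)
      have hcp : DifferentiableAt ℝ c p := hc.differentiable two_ne_zero p
      refine ⟨(hfp.restrictScalars ℝ).mul hcp, fun a => ?_⟩
      rw [dbar_mul (hfp.restrictScalars ℝ) hcp, dbar_eq_zero_of_differentiableAt hfp, mul_zero,
        add_zero]
  let F : X → ℂ := fun p => f p * c p - u p
  have hF : DifferentiableOn ℂ F Ω := fun p hp =>
    (differentiableAt_of_dbar_eq_zero ((hcf p hp).1.fun_sub (hud p)) fun a => by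
      rw [dbar_sub (hcf p hp).1 (hud p), (hcf p hp).2, hu, sub_self]).differentiableWithinAt
  have hFf : Set.EqOn F f (Ω \ E) := by
    obtain ⟨p, hp, hup⟩ := exists_mem_eventuallyEq_zero hΩ hSΩ hS (hEne.mono hES) huS hu0
    have h0 : (fun q => F q - f q) =ᶠ[nhds p] 0 := by
      filter_upwards [hup, hcS p hp.2] with q hq1 hq2
      simp [F, hq1, hq2]
    intro q hq
    exact sub_eq_zero.1 (eqOn_zero_of_eventuallyEq_zero_of_isPreconnected (hΩ.sdiff hE) hconn
      ((hF.mono Set.sdiff_subset).sub hf) ⟨hp.1, fun h => hp.2 (hES h)⟩ h0 hq)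
  refine ⟨F, hF, ?_, hFf⟩
  -- Pointwise `‖v e‖ ≤ 2 * C * ‖e‖ * ‖f‖` on `Ω \ E`, and `v e = 0` elsewhere.
  have hv2 : MemLp (v e) 2 μ := by
    have h1 : MemLp ((Ω \ E).indicator f) 2 μ :=
      (memLp_indicator_iff_restrict (hΩ.sdiff hE).measurableSet).2 hf2
    refine h1.of_le_mul (c := 2 * C * ‖e‖) (hv e).continuous.aestronglyMeasurable
      (Filter.Eventually.of_forall fun p => ?_)
    by_cases hp : p ∈ Ω \ E
    · rw [Set.indicator_of_mem hp]
      have h2 : ‖fderiv ℝ c p‖ ≤ C := by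
        refine le_trans ?_ (hC p)
        have h3 := Complex.ofRealCLM.hasFDerivAt.comp p
          (hχ.differentiable two_ne_zero p).hasFDerivAt
        change HasFDerivAt c _ p at h3
        rw [h3.fderiv]
        refine ContinuousLinearMap.opNorm_le_bound _ (norm_nonneg _) fun x => ?_
        simpa using (fderiv ℝ χ p).le_opNorm x
      rw [norm_mul, mul_comm]
      gcongr
      exact norm_dbar_le h2 e
    · simp [v, hdc0 p hp, Set.indicator_of_notMem hp]
  have hFE : MemLp F 2 ((μ.restrict Ω).restrict E) := by
    have h1 : MemLp (fun p => -u p) 2 (μ.restrict E) := (memLp_two_lineCauchyTransform hA hRS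
      (hv e).continuous (hv0 e) hv2 hE.measurableSet hES hud.continuous).neg
    rw [Measure.restrict_restrict hE.measurableSet]
    refine (h1.ae_eq ?_).mono_measure (Measure.restrict_mono_set μ Set.inter_subset_left)
    filter_upwards [ae_restrict_mem hE.measurableSet] with p hp
    simp [F, (hcE p hp).self_of_nhds]
  have hFE' : MemLp F 2 ((μ.restrict Ω).restrict Eᶜ) := by
    rw [Measure.restrict_restrict hE.measurableSet.compl, Set.inter_comm, ← Set.sdiff_eq]
    refine hf2.ae_eq ?_
    filter_upwards [ae_restrict_mem (hΩ.sdiff hE).measurableSet] with p hp using (hFf hp).symm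
  classical
  simpa using MemLp.piecewise hE.measurableSet hFE hFE'

end

/-! ### Choosing the complex direction. -/

theorem Submodule.exists_mem_notMem_span_pair {K W : Type*} [Field K] [AddCommGroup W] [Module K W]
    {N : Submodule K W} (hN : 3 ≤ Module.finrank K N) (x y : W) :
    ∃ z ∈ N, z ∉ Submodule.span K {x, y} := by
  classical
  by_contra! h
  have : FiniteDimensional K (Submodule.span K ({x, y} : Set W)) :=
    FiniteDimensional.span_of_finite K (by simp)
  have h1 : Module.finrank K N ≤ Module.finrank K (Submodule.span K ({x, y} : Set W)) :=
    Submodule.finrank_mono h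
  have h2 := finrank_span_finset_le_card (R := K) ({x, y} : Finset W)
  rw [Finset.coe_pair] at h2
  have h3 : ({x, y} : Finset W).card ≤ 2 := Finset.card_le_two
  have h4 : Module.finrank K (Submodule.span K ({x, y} : Set W)) ≤ _ := h2
  omega

/-- The annihilator of `V` has real dimension at least 3, so each choice in it can avoid a real span
of two functionals: `a` nonzero, `b` outside the span of `a` and `a ∘ I`, `c` outside the span of
`a` and `b`. The second choice makes the complexifications of `a` and `b` independent over ℂ. -/
theorem exists_transversal_complex_line {X : Type*} [NormedAddCommGroup X] [NormedSpace ℂ X]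
    [FiniteDimensional ℂ X] (V : Submodule ℝ X) (hV : 3 ≤ Module.finrank ℝ (X ⧸ V)) :
    ∃ (e : X) (A : X →L[ℝ] ℂ) (m : X →L[ℝ] ℝ), (∀ t : ℂ, A (t • e) = t) ∧ m ≠ 0 ∧
      (∀ t : ℂ, m (t • e) = 0) ∧ ∀ x ∈ V, A x = 0 ∧ m x = 0 := by
  have : FiniteDimensional ℝ X := FiniteDimensional.complexToReal X
  have hN : 3 ≤ Module.finrank ℝ V.dualAnnihilator := by
    rwa [← V.dualQuotEquivDualAnnihilator.finrank_eq, Subspace.dual_finrank_eq]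
  have hV0 : ∀ g ∈ V.dualAnnihilator, ∀ x ∈ V, g x = 0 := fun g hg =>
    (Submodule.mem_dualAnnihilator g).1 hg
  obtain ⟨a, haN, ha⟩ := Submodule.exists_mem_notMem_span_pair hN 0 0
  let Ja : Module.Dual ℝ X := a ∘ₗ ((LinearMap.lsmul ℂ X Complex.I).restrictScalars ℝ)
  have hJa : ∀ x, Ja x = a (Complex.I • x) := fun x => rfl
  obtain ⟨b, hbN, hb⟩ := Submodule.exists_mem_notMem_span_pair hN a Ja
  obtain ⟨c, hcN, hc⟩ := Submodule.exists_mem_notMem_span_pair hN a b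
  have hre : ∀ (g : Module.Dual ℝ X) x, (g.extendRCLike (𝕜 := ℂ)) x =
      (g x : ℂ) - Complex.I * (g (Complex.I • x) : ℂ) := fun g x => by
    simp [Module.Dual.extendRCLike_apply]
  obtain ⟨y, hy⟩ : ∃ y, a.extendRCLike (𝕜 := ℂ) y ≠ 0 := by
    by_contra! h
    have : a = 0 := by
      ext y
      have := congrArg Complex.re (h y)
      rw [hre] at this
      simpa using this
    exact ha (by simp [this])
  obtain ⟨x, hax, hbx⟩ : ∃ x, a.extendRCLike (𝕜 := ℂ) x = 0 ∧ b.extendRCLike (𝕜 := ℂ) x ≠ 0 := by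
    by_contra! h
    have hle : ⨅ i, LinearMap.ker ((![a, Ja] : Fin 2 → Module.Dual ℝ X) i) ≤ LinearMap.ker b := by
      intro x hx
      simp only [Submodule.mem_iInf, LinearMap.mem_ker, Fin.forall_fin_two, Matrix.cons_val_zero,
        Matrix.cons_val_one, hJa] at hx
      have h1 := h x (by rw [hre, hx.1, hx.2]; simp)
      have h2 := congrArg Complex.re h1
      rw [hre] at h2
      simpa using h2
    have := FiniteDimensional.mem_span_of_iInf_ker_le_ker hle
    rw [Matrix.range_cons_cons_empty] at this
    exact hb this
  let α := a.extendRCLike (𝕜 := ℂ)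
  let β := b.extendRCLike (𝕜 := ℂ)
  -- Solves `α e = 1` and `β e = -I`, so that `a (t • e) = t.re` and `b (t • e) = t.im`.
  let e : X := (α y)⁻¹ • y + ((-Complex.I - β y / α y) / β x) • x
  have hαe : α e = 1 := by
    have : α x = 0 := hax
    simp only [e, map_add, map_smul, smul_eq_mul, this, mul_zero, add_zero]
    exact inv_mul_cancel₀ hy
  have hβe : β e = -Complex.I := by
    have h1 : β x ≠ 0 := hbx
    have h2 : α y ≠ 0 := hy
    simp only [e, map_add, map_smul, smul_eq_mul]
    field_simp
    ring
  have hre' : ∀ (g : Module.Dual ℝ X) (t : ℂ), g (t • e) = (t * g.extendRCLike (𝕜 := ℂ) e).re := by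
    intro g t
    rw [← smul_eq_mul, ← map_smul, hre]
    simp
  have hae : ∀ t : ℂ, a (t • e) = t.re := fun t => by
    rw [hre', show a.extendRCLike (𝕜 := ℂ) e = 1 from hαe, mul_one]
  have hbe : ∀ t : ℂ, b (t • e) = t.im := fun t => by
    rw [hre', show b.extendRCLike (𝕜 := ℂ) e = -Complex.I from hβe]
    simp
  let A : X →ₗ[ℝ] ℂ := Complex.ofRealCLM.toLinearMap ∘ₗ a +
    Complex.I • (Complex.ofRealCLM.toLinearMap ∘ₗ b)
  have hA : ∀ x, A x = a x + Complex.I * b x := fun x => rfl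
  -- Correcting `c` by `a` and `b` kills it on `ℂ e`; it stays nonzero because `c` is outside their
  -- span.
  let m : Module.Dual ℝ X := c - c e • a - c (Complex.I • e) • b
  have hmx : ∀ x, m x = c x - c e * a x - c (Complex.I • e) * b x := fun x => rfl
  refine ⟨e, LinearMap.toContinuousLinearMap A, LinearMap.toContinuousLinearMap m,
    fun t => ?_, fun h => ?_, fun t => ?_, fun x hx => ?_⟩
  · change A (t • e) = t
    rw [hA, hae, hbe, mul_comm]
    exact Complex.re_add_im t
  · have h0 : m = 0 := by
      ext x
      exact DFunLike.congr_fun h x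
    have hceq : c = c e • a + c (Complex.I • e) • b := by
      rw [← sub_eq_zero, ← sub_sub]
      exact h0
    exact hc (Submodule.mem_span_pair.2 ⟨_, _, hceq.symm⟩)
  · change m (t • e) = 0
    have h1 : t • e = t.re • e + t.im • (Complex.I • e) := by
      conv_lhs => rw [← Complex.re_add_im t]
      rw [add_smul, mul_smul]
      simp only [Complex.coe_smul]
    rw [hmx, hae, hbe, h1, map_add, map_smul, map_smul]
    simp only [smul_eq_mul]
    ring
  · change A x = 0 ∧ m x = 0
    rw [hA, hmx, hV0 a haN x hx, hV0 b hbN x hx, hV0 c hcN x hx]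
    simp

/-! ### Conclusion. -/

theorem theorem1p4 (n : ℕ) (Ω E : Set (EuclideanSpace ℂ (Fin n)))
    (hΩ_open : IsOpen Ω) (hΩ_conn : IsConnected Ω) (hE_closed : IsClosed E)
    (hE_nhd : ∃ r : ℝ, 0 < r ∧ Metric.cthickening r E ⊆ Ω)
    (hE_slab : ∃ (H : AffineSubspace ℝ (EuclideanSpace ℂ (Fin n))) (R : ℝ),
      (H : Set (EuclideanSpace ℂ (Fin n))).Nonempty ∧
      3 ≤ Module.finrank ℝ (EuclideanSpace ℂ (Fin n) ⧸ H.direction) ∧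
      0 < R ∧ E ⊆ Metric.thickening R (H : Set (EuclideanSpace ℂ (Fin n))))
    (h_conn : IsConnected (Ω \ E))
    (f : EuclideanSpace ℂ (Fin n) → ℂ)
    (hf_hol : DifferentiableOn ℂ f (Ω \ E))
    (hf_L2 : MemLp f 2 (volume.restrict (Ω \ E))) :
    ∃ F : EuclideanSpace ℂ (Fin n) → ℂ,
      DifferentiableOn ℂ F Ω ∧ MemLp F 2 (volume.restrict Ω) ∧ Set.EqOn F f (Ω \ E) := by
  -- The clopen argument needs a nonempty `E`; for empty `E`, `f` itself is the extension.
  rcases E.eq_empty_or_nonempty with rfl | hEne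
  · rw [Set.sdiff_empty] at *
    exact ⟨f, hf_hol, hf_L2, Set.eqOn_refl f Ω⟩
  obtain ⟨r, hr, hrΩ⟩ := hE_nhd
  obtain ⟨H, R, ⟨h₀, hh₀⟩, hcodim, hR, hER⟩ := hE_slab
  obtain ⟨e, A, m, hAe, hm, hme, hAm⟩ := exists_transversal_complex_line H.direction hcodim
  -- `A` and `m` are constant on `H`, so on `E` they differ from their values at `h₀` by their
  -- values on a vector of norm at most `R`.
  have hnear : ∀ q ∈ E, ∃ z : EuclideanSpace ℂ (Fin n), ‖z‖ ≤ R ∧ A q = A h₀ + A z ∧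
      m q = m h₀ + m z := fun q hq => by
    obtain ⟨h, hh, hqh⟩ := Metric.mem_thickening_iff.1 (hER hq)
    obtain ⟨h1, h2⟩ := hAm (h - h₀) (AffineSubspace.vsub_mem_direction hh hh₀)
    rw [map_sub, sub_eq_zero] at h1 h2
    refine ⟨q - h, by rw [← dist_eq_norm]; exact hqh.le, ?_, ?_⟩
    · rw [map_sub, ← h1, add_sub_cancel]
    · rw [map_sub, ← h2, add_sub_cancel]
  refine exists_holomorphic_extension_of_bounded_slices volume hΩ_open hE_closed hEne hr hrΩ hAe
    (R := ‖A h₀‖ + ‖A‖ * R) (fun q hq => ?_) hm hme (M := m h₀ + ‖m‖ * R) (fun q hq => ?_)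
    h_conn.isPreconnected hf_hol hf_L2
  · obtain ⟨z, hz, hAz, -⟩ := hnear q hq
    rw [hAz]
    exact (norm_add_le _ _).trans (by gcongr; exact (A.le_opNorm z).trans (by gcongr))
  · obtain ⟨z, hz, -, hmz⟩ := hnear q hq
    rw [hmz]
    gcongr
    exact (le_abs_self _).trans ((m.le_opNorm z).trans (by gcongr))
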